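/- A word $x$ is a factor of a word $w$ if $w = yxz$ for some words $y,z$, and $x^R$ denotes the reversal of $x$. A word $w$ avoids reversed factors of length $\geq 2$ if for every factor $x$ of $w$ with $|x| \geq 2$, the word $x^R$ is not a factor of $w$. Let $r_{42}(n)$ denote the number of length-$n$ words over the alphabet $\Sigma_4 = \{0,1,2,3\}$ that avoid reversed factors of length $\geq 2$. Then $$(r_{42}(0), r_{42}(1), \ldots, r_{42}(16)) = (1,4,12,24,48,96,168,264,456,720,1056,1656,2520,3600,5352,7944,11256)$$ and, for all $n \geq 17$, $$r_{42}(n) = r_{42}(n-1) + 5r_{42}(n-3) - 3r_{42}(n-4) - 2r_{42}(n-5) - 8r_{42}(n-6) + r_{42}(n-7) + 6r_{42}(n-8) + 5r_{42}(n-9) + 2r_{42}(n-10) - 4r_{42}(n-11) - 2r_{42}(n-12).$$ Moreover, there is a real constant $C$ such that $r_{42}(n) \sim C\,\alpha^n$ as $n \to \infty$, where $\alpha$ is the largest real zero of $X^4 - 2X - 1$; here $\alpha \doteq 1.395336994$ and $C \doteq 71.2145756$ (each correctly rounded, that is, $|\alpha - 1.395336994| \leq 5\cdot 10^{-10}$ and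 $|C - 71.2145756| \leq 5 \cdot 10^{-8}$). -/

import Mathlib

open Filter Asymptotics

/-- The word `w` avoids reversed factors of length `≥ ℓ`: whenever `x` is a factor (contiguous
subword) of `w` with `|x| ≥ ℓ`, the reversal of `x` is not a factor of `w`. -/
def AvoidsReversedFactors {A : Type*} (ℓ : ℕ) (w : List A) : Prop :=
  ∀ x : List A, x <:+: w → ℓ ≤ x.length → ¬ x.reverse <:+: w

/-- The language of all words over the alphabet `{0, 1, …, k - 1}` avoiding reversed factors of
length `≥ ℓ`. -/
def avoidingLanguage (ℓ k : ℕ) : Language (Fin k) :=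
  {w | AvoidsReversedFactors ℓ w}

/-- The number of words of length `n` over `{0, 1, …, k - 1}` avoiding reversed factors of
length `≥ ℓ` (the set counted is finite). -/
noncomputable def avoidingCount (k ℓ n : ℕ) : ℕ :=
  Set.ncard {w : List (Fin k) | w ∈ avoidingLanguage ℓ k ∧ w.length = n}

/-- The number of words of length `n` over `{0, 1, 2, 3}` avoiding reversed factors of
length `≥ 2`. -/
noncomputable def r42 (n : ℕ) : ℕ := avoidingCount 4 2 n

/-!
A word avoids reversed factors of length at least two if and only if it never contains both `ab` and
`ba`, also not for `a = b`. Read as a walk on the vertices `0, 1, 2, 3`, it uses each edge of the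
complete graph in at most one direction. Inclusion–exclusion on each of the six edges ("in the first
direction only" plus "in the second direction only" minus "not at all") shows that the number of
such words of length `k + 1` is the sum, over the `3 ^ 6` oriented graphs on four vertices and with
the sign `(-1) ^ (number of missing edges)`, of the number of walks with `k` arcs
(`signedSum_isChain`, `OrientedGraph.sum_isChain`).

The adjacency matrix of an oriented graph with `t` directed triangles and `f` directed four-cycles
has characteristic polynomial `X ^ 4 - t * X - f` (`OrientedGraph.walks_add_four`), where `t ≤ 2`
and `f ≤ 1`. Grouping the graphs by `(t, f)` writes the count as a sum of six sequences, each with a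
recurrence of order four (`r42_succ`, `cycleClassSum_add_four`), whose initial values are a finite
computation (`cycleClassSum_initial`). It turns out that, beyond `k = 0`, the three classes with
`t + f ≤ 1` contribute the constants `0`, `24` and `24`. What is left has characteristic polynomial
`(X - 1) * (X ^ 3 - 2) * (X ^ 4 - X - 1) * (X ^ 4 - 2 * X - 1)`, which is the one of the asserted
recurrence (`r42_add_seventeen`).

Only `X ^ 4 - 2 * X - 1` has a root `α` of modulus above `1.3`. A left eigenvector of its shift gives
the exact coefficient of `α ^ k`, as a rational function of `α`, and the remaining part of the
sequence is `O(1.3 ^ k)` (`sub_dominant_isBigO`).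
-/

/-! ### Words and their two-letter factors -/

theorem List.isChain_iff_forall_pair_infix {A : Type*} {R : A → A → Prop} {w : List A} :
    w.IsChain R ↔ ∀ a b, [a, b] <:+: w → R a b :=
  ⟨fun h a b hab ↦ by simpa using h.infix hab, fun h ↦ (List.isChain_isInfix w).imp h⟩

/-- Only factors of length two matter: reversing a factor that starts with `ab` produces one
that ends with `ba`. -/
theorem avoidsReversedFactors_two_iff {A : Type*} {w : List A} :
    AvoidsReversedFactors 2 w ↔ ∀ a b, [a, b] <:+: w → ¬ [b, a] <:+: w := by
  constructor
  · intro h a b hab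
    simpa using h [a, b] hab le_rfl
  · intro h x hx hl hr
    match x, hl with
    | a :: b :: x, _ =>
      refine h a b (.trans ⟨[], x, rfl⟩ hx) (.trans ⟨x.reverse, [], ?_⟩ hr)
      simp

theorem avoidingCount_eq_sum (k ℓ n : ℕ) [DecidablePred (AvoidsReversedFactors (A := Fin k) ℓ)] :
    avoidingCount k ℓ n =
      ∑ w : Fin n → Fin k, if AvoidsReversedFactors ℓ (List.ofFn w) then 1 else 0 := by
  have h : {w : List (Fin k) | w ∈ avoidingLanguage ℓ k ∧ w.length = n} =
      List.ofFn '' {w : Fin n → Fin k | AvoidsReversedFactors ℓ (List.ofFn w)} := by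
    ext w
    constructor
    · rintro ⟨hw, rfl⟩
      exact ⟨w.get, by rw [Set.mem_ofPred_eq, List.ofFn_get]; exact hw, List.ofFn_get w⟩
    · rintro ⟨v, hv, rfl⟩
      exact ⟨hv, List.length_ofFn⟩
  rw [avoidingCount, h, Set.ncard_image_of_injective _ List.ofFn_injective,
    Set.ncard_eq_toFinset_card', Set.toFinset_ofPred, Finset.card_filter]

/-! ### Oriented graphs on four vertices -/

/-- An oriented graph on the vertices `0, 1, 2, 3`. The field `eij` (with `i < j`) tells what
happens between `i` and `j`: an arc from `i` to `j` (`pos`), an arc from `j` to `i` (`neg`), or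
nothing (`zero`). -/
structure OrientedGraph where
  (e01 e02 e03 e12 e13 e23 : SignType)

/-- Whether a sign is `pos`, by pattern matching so that the kernel evaluates it quickly. -/
def SignType.isPos : SignType → Bool
  | .pos => true
  | _ => false

/-- Whether a sign is `neg`, by pattern matching so that the kernel evaluates it quickly. -/
def SignType.isNeg : SignType → Bool
  | .neg => true
  | _ => false

/-- The adjacency relation of an oriented graph. -/
def OrientedGraph.arc (c : OrientedGraph) : Fin 4 → Fin 4 → Bool :=
  ![![false, c.e01.isPos, c.e02.isPos, c.e03.isPos],
    ![c.e01.isNeg, false, c.e12.isPos, c.e13.isPos],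
    ![c.e02.isNeg, c.e12.isNeg, false, c.e23.isPos],
    ![c.e03.isNeg, c.e13.isNeg, c.e23.isNeg, false]]

/-- The signed sum over the three states of one edge; an absent edge counts negatively. -/
def edgeSum (F : SignType → ℤ) : ℤ := F .pos + F .neg - F .zero

/-- The sum of `(-1) ^ m(c) * F c` over all oriented graphs `c` on four vertices, where `m(c)` is
the number of non-adjacent pairs of vertices of `c`. -/
def signedSum (F : OrientedGraph → ℤ) : ℤ :=
  edgeSum fun p ↦ edgeSum fun q ↦ edgeSum fun r ↦ edgeSum fun s ↦ edgeSum fun t ↦ edgeSum fun u ↦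
    F ⟨p, q, r, s, t, u⟩

theorem edgeSum_add (F G : SignType → ℤ) :
    edgeSum (fun x ↦ F x + G x) = edgeSum F + edgeSum G := by
  simp only [edgeSum]; ring

theorem edgeSum_const_mul (a : ℤ) (F : SignType → ℤ) :
    edgeSum (fun x ↦ a * F x) = a * edgeSum F := by
  simp only [edgeSum]; ring

theorem edgeSum_mul_const (a : ℤ) (F : SignType → ℤ) :
    edgeSum (fun x ↦ F x * a) = edgeSum F * a := by
  simp only [edgeSum]; ring

theorem signedSum_add (F G : OrientedGraph → ℤ) :
    signedSum (fun c ↦ F c + G c) = signedSum F + signedSum G := by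
  simp only [signedSum, ← edgeSum_add]

theorem signedSum_const_mul (a : ℤ) (F : OrientedGraph → ℤ) :
    signedSum (fun c ↦ a * F c) = a * signedSum F := by
  simp only [signedSum, ← edgeSum_const_mul]

theorem signedSum_zero : signedSum (fun _ ↦ 0) = 0 := by
  simpa using signedSum_const_mul 0 fun _ ↦ 0

theorem signedSum_prod (f₁ f₂ f₃ f₄ f₅ f₆ : SignType → ℤ) :
    signedSum (fun c ↦ f₁ c.e01 * (f₂ c.e02 * (f₃ c.e03 * (f₄ c.e12 * (f₅ c.e13 * f₆ c.e23))))) =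
      edgeSum f₁ * (edgeSum f₂ * (edgeSum f₃ * (edgeSum f₄ * (edgeSum f₅ * edgeSum f₆)))) := by
  unfold signedSum
  rw [← edgeSum_mul_const _ f₁]
  congr 1; funext p
  rw [← edgeSum_mul_const _ f₂, ← edgeSum_const_mul (f₁ p)]
  congr 1; funext q
  rw [← edgeSum_mul_const _ f₃, ← edgeSum_const_mul (f₂ q), ← edgeSum_const_mul (f₁ p)]
  congr 1; funext r
  rw [← edgeSum_mul_const _ f₄, ← edgeSum_const_mul (f₃ r), ← edgeSum_const_mul (f₂ q),
    ← edgeSum_const_mul (f₁ p)]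
  congr 1; funext s
  rw [← edgeSum_mul_const _ f₅, ← edgeSum_const_mul (f₄ s), ← edgeSum_const_mul (f₃ r),
    ← edgeSum_const_mul (f₂ q), ← edgeSum_const_mul (f₁ p)]
  congr 1; funext t
  rw [← edgeSum_const_mul (f₅ t), ← edgeSum_const_mul (f₄ s), ← edgeSum_const_mul (f₃ r),
    ← edgeSum_const_mul (f₂ q), ← edgeSum_const_mul (f₁ p)]

theorem signedSum_sum {ι : Type*} (S : Finset ι) (F : ι → OrientedGraph → ℤ) :
    signedSum (fun c ↦ ∑ i ∈ S, F i c) = ∑ i ∈ S, signedSum (F i) := by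
  classical
  induction S using Finset.induction_on with
  | empty => simpa using signedSum_zero
  | insert i S hi ih => simp only [Finset.sum_insert hi, signedSum_add, ih]

theorem edgeSum_indicator (P Q : Prop) [Decidable P] [Decidable Q] :
    edgeSum (fun x ↦ if (P → x.isPos) ∧ (Q → x.isNeg) then 1 else 0) =
      if P → ¬ Q then 1 else 0 := by
  by_cases P <;> by_cases Q <;> simp_all [edgeSum, SignType.isPos, SignType.isNeg]

/-- Inclusion–exclusion for a set `U` of pairs of vertices. For a single edge, a set that contains
neither of its two directions is counted `1 + 1 - 1` times, a set that contains just one of them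
once, and a set that contains both not at all. -/
theorem signedSum_forall_arc (U : Fin 4 → Fin 4 → Prop) [DecidableRel U] :
    signedSum (fun c ↦ if ∀ a b, U a b → c.arc a b then 1 else 0) =
      if ∀ a b, U a b → ¬ U b a then 1 else 0 := by
  by_cases hl : ∃ a, U a a
  · obtain ⟨a, ha⟩ := hl
    have h0 : ∀ c : OrientedGraph, ¬ ∀ a b, U a b → c.arc a b := by
      intro c h
      have := h a a ha
      fin_cases a <;> simp [OrientedGraph.arc] at this
    have h1 : ¬ ∀ a b, U a b → ¬ U b a := fun h ↦ h a a ha ha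
    simpa [h0, h1] using signedSum_zero
  · push Not at hl
    have h0 : ∀ c : OrientedGraph, (if ∀ a b, U a b → c.arc a b then (1 : ℤ) else 0) =
        (if (U 0 1 → c.e01.isPos) ∧ (U 1 0 → c.e01.isNeg) then 1 else 0) *
        ((if (U 0 2 → c.e02.isPos) ∧ (U 2 0 → c.e02.isNeg) then 1 else 0) *
        ((if (U 0 3 → c.e03.isPos) ∧ (U 3 0 → c.e03.isNeg) then 1 else 0) *
        ((if (U 1 2 → c.e12.isPos) ∧ (U 2 1 → c.e12.isNeg) then 1 else 0) *
        ((if (U 1 3 → c.e13.isPos) ∧ (U 3 1 → c.e13.isNeg) then 1 else 0) *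
        (if (U 2 3 → c.e23.isPos) ∧ (U 3 2 → c.e23.isNeg) then 1 else 0))))) := by
      intro c
      simp only [ite_zero_mul_ite_zero, mul_one]
      congr 1
      simp only [Fin.forall_fin_succ, Fin.forall_fin_zero, OrientedGraph.arc, eq_iff_iff]
      simp [hl]
      tauto
    rw [funext h0, signedSum_prod
      (fun x ↦ if (U 0 1 → x.isPos) ∧ (U 1 0 → x.isNeg) then 1 else 0)
      (fun x ↦ if (U 0 2 → x.isPos) ∧ (U 2 0 → x.isNeg) then 1 else 0)
      (fun x ↦ if (U 0 3 → x.isPos) ∧ (U 3 0 → x.isNeg) then 1 else 0)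
      (fun x ↦ if (U 1 2 → x.isPos) ∧ (U 2 1 → x.isNeg) then 1 else 0)
      (fun x ↦ if (U 1 3 → x.isPos) ∧ (U 3 1 → x.isNeg) then 1 else 0)
      (fun x ↦ if (U 2 3 → x.isPos) ∧ (U 3 2 → x.isNeg) then 1 else 0)]
    simp only [edgeSum_indicator]
    simp only [ite_zero_mul_ite_zero, mul_one]
    congr 1
    simp only [Fin.forall_fin_succ, Fin.forall_fin_zero, eq_iff_iff]
    simp [hl]
    tauto

open Classical in
/-- A word avoids reversed factors of length at least two exactly when it is a walk in some
oriented graph; the signed number of such graphs is then one. -/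
theorem signedSum_isChain (w : List (Fin 4)) :
    signedSum (fun c ↦ if w.IsChain (fun a b ↦ c.arc a b) then 1 else 0) =
      if AvoidsReversedFactors 2 w then 1 else 0 := by
  refine (congrArg signedSum (funext fun c ↦ ?_)).trans
    ((signedSum_forall_arc fun a b ↦ [a, b] <:+: w).trans ?_)
  · exact if_congr List.isChain_iff_forall_pair_infix rfl rfl
  · exact if_congr avoidsReversedFactors_two_iff.symm rfl rfl

/-! ### Counting walks in an oriented graph -/

/-- The entries of a vector indexed by the four vertices, stored as nested pairs so that the kernel
evaluates it quickly. -/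
def vertexEntry (w : ℕ × ℕ × ℕ × ℕ) : Fin 4 → ℕ := ![w.1, w.2.1, w.2.2.1, w.2.2.2]

namespace OrientedGraph

/-- Multiplication of a vector by the adjacency matrix. -/
def step (c : OrientedGraph) (w : ℕ × ℕ × ℕ × ℕ) : ℕ × ℕ × ℕ × ℕ :=
  match c, w with
  | ⟨p, q, r, s, t, u⟩, (w₀, w₁, w₂, w₃) =>
    ((bif p.isPos then w₁ else 0) + (bif q.isPos then w₂ else 0) + (bif r.isPos then w₃ else 0),
      (bif p.isNeg then w₀ else 0) + (bif s.isPos then w₂ else 0) + (bif t.isPos then w₃ else 0),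
      (bif q.isNeg then w₀ else 0) + (bif s.isNeg then w₁ else 0) + (bif u.isPos then w₃ else 0),
      (bif r.isNeg then w₀ else 0) + (bif t.isNeg then w₁ else 0) + (bif u.isNeg then w₂ else 0))

/-- The numbers of walks with `k` arcs from each of the four vertices. -/
def walks (c : OrientedGraph) : ℕ → ℕ × ℕ × ℕ × ℕ
  | 0 => (1, 1, 1, 1)
  | k + 1 => c.step (walks c k)

/-- The number of directed triangles. -/
def triangles : OrientedGraph → ℕ
  | ⟨p, q, r, s, t, u⟩ =>
    (p.isPos && s.isPos && q.isNeg).toNat + (p.isNeg && s.isNeg && q.isPos).toNat +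
    (p.isPos && t.isPos && r.isNeg).toNat + (p.isNeg && t.isNeg && r.isPos).toNat +
    (q.isPos && u.isPos && r.isNeg).toNat + (q.isNeg && u.isNeg && r.isPos).toNat +
    (s.isPos && u.isPos && t.isNeg).toNat + (s.isNeg && u.isNeg && t.isPos).toNat

/-- The number of directed four-cycles. -/
def fourCycles : OrientedGraph → ℕ
  | ⟨p, q, r, s, t, u⟩ =>
    (p.isPos && s.isPos && u.isPos && r.isNeg).toNat +
    (p.isNeg && s.isNeg && u.isNeg && r.isPos).toNat +
    (p.isPos && t.isPos && u.isNeg && q.isNeg).toNat +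
    (p.isNeg && t.isNeg && u.isPos && q.isPos).toNat +
    (q.isPos && s.isNeg && t.isPos && r.isNeg).toNat +
    (q.isNeg && s.isPos && t.isNeg && r.isPos).toNat

/-- The total number of walks with `k` arcs. -/
def totalWalks (c : OrientedGraph) (k : ℕ) : ℕ :=
  match c.walks k with
  | (w₀, w₁, w₂, w₃) => w₀ + w₁ + w₂ + w₃

theorem vertexEntry_step (c : OrientedGraph) (w : ℕ × ℕ × ℕ × ℕ) (a : Fin 4) :
    vertexEntry (c.step w) a = ∑ b, if c.arc a b then vertexEntry w b else 0 := by
  fin_cases a <;>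
    simp [vertexEntry, step, arc, Fin.sum_univ_four, Bool.cond_eq_ite] <;> rfl

theorem totalWalks_eq_sum (c : OrientedGraph) (k : ℕ) :
    c.totalWalks k = ∑ a, vertexEntry (c.walks k) a := by
  simp [totalWalks, vertexEntry, Fin.sum_univ_four]

/-- Words of length `k + 1` that start with `a` and follow the arcs of `c` are the walks with `k`
arcs from `a`. -/
theorem sum_isChain_cons (c : OrientedGraph) (k : ℕ) (a : Fin 4) :
    (∑ w : Fin k → Fin 4, if (a :: List.ofFn w).IsChain (fun a b ↦ c.arc a b) then 1 else 0) =
      vertexEntry (c.walks k) a := by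
  induction k generalizing a with
  | zero => fin_cases a <;> simp [walks, vertexEntry]
  | succ k ih =>
    rw [walks, vertexEntry_step, ← (Fin.consEquiv fun _ ↦ Fin 4).sum_comp, Fintype.sum_prod_type]
    refine Finset.sum_congr rfl fun b _ ↦ ?_
    simp only [Fin.consEquiv, Equiv.coe_fn_mk, List.ofFn_cons, List.isChain_cons_cons]
    by_cases h : c.arc a b <;> simp [h, ← ih]

theorem sum_isChain (c : OrientedGraph) (k : ℕ) :
    (∑ w : Fin (k + 1) → Fin 4, if (List.ofFn w).IsChain (fun a b ↦ c.arc a b) then 1 else 0) =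
      c.totalWalks k := by
  rw [totalWalks_eq_sum, ← (Fin.consEquiv fun _ ↦ Fin 4).sum_comp, Fintype.sum_prod_type]
  refine Finset.sum_congr rfl fun a _ ↦ ?_
  simp only [Fin.consEquiv, Equiv.coe_fn_mk, List.ofFn_cons, sum_isChain_cons]

theorem step_smul_add_smul (c : OrientedGraph) (a b : ℕ) (v w : ℕ × ℕ × ℕ × ℕ) :
    c.step (a • v + b • w) = a • c.step v + b • c.step w := by
  obtain ⟨p, q, r, s, t, u⟩ := c
  simp only [step, Prod.ext_iff, Prod.fst_add, Prod.snd_add, Prod.smul_fst, Prod.smul_snd,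
    smul_eq_mul, Bool.cond_eq_ite]
  refine ⟨?_, ?_, ?_, ?_⟩ <;> split_ifs <;> ring

/-- The Cayley–Hamilton theorem for the adjacency matrix, applied to the all-ones vector. The
characteristic polynomial is `X ^ 4 - t * X - f`, where `t` is the number of directed triangles and
`f` the number of directed four-cycles, because every directed cycle has at least three vertices, so
that no two of them are disjoint. -/
theorem walks_add_four (c : OrientedGraph) (k : ℕ) :
    c.walks (k + 4) = c.triangles • c.walks (k + 1) + c.fourCycles • c.walks k := by
  induction k with
  | zero =>
    have h : ∀ p q r s t u : SignType, (mk p q r s t u).walks 4 =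
        (mk p q r s t u).triangles • (mk p q r s t u).walks 1 +
          (mk p q r s t u).fourCycles • (mk p q r s t u).walks 0 := by
      decide +kernel
    exact h ..
  | succ k ih => rw [walks, ih, step_smul_add_smul]; rfl

theorem totalWalks_add_four (c : OrientedGraph) (k : ℕ) :
    c.totalWalks (k + 4) = c.triangles * c.totalWalks (k + 1) + c.fourCycles * c.totalWalks k := by
  simp only [totalWalks, walks_add_four, Prod.fst_add, Prod.snd_add, Prod.smul_fst, Prod.smul_snd,
    smul_eq_mul]
  ring

/-- Whether `c` has `t` directed triangles and `f` directed four-cycles. -/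
def hasCycles (t f : ℕ) (c : OrientedGraph) : Bool := c.triangles == t && c.fourCycles == f

end OrientedGraph

/-- The contribution to the signed sum of the numbers of walks that comes from the oriented graphs
with `t` directed triangles and `f` directed four-cycles. -/
def cycleClassSum (t f k : ℕ) : ℤ :=
  signedSum fun c ↦ bif c.hasCycles t f then c.totalWalks k else 0

theorem cycleClassSum_add_four (t f k : ℕ) :
    cycleClassSum t f (k + 4) = t * cycleClassSum t f (k + 1) + f * cycleClassSum t f k := by
  simp only [cycleClassSum, ← signedSum_const_mul, ← signedSum_add]
  congr 1
  funext c
  by_cases h : c.hasCycles t f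
  · obtain ⟨rfl, rfl⟩ : c.triangles = t ∧ c.fourCycles = f := by
      simpa [OrientedGraph.hasCycles] using h
    simp [h, OrientedGraph.totalWalks_add_four]
  · simp [h]

/-- An oriented graph on four vertices has at most two directed triangles and at most one directed
four-cycle, so the six classes listed here cover all cases. -/
theorem OrientedGraph.sum_hasCycles (c : OrientedGraph) (x : ℤ) :
    x = (bif c.hasCycles 0 0 then x else 0) + (bif c.hasCycles 1 0 then x else 0) +
      (bif c.hasCycles 0 1 then x else 0) + (bif c.hasCycles 2 0 then x else 0) +
      (bif c.hasCycles 1 1 then x else 0) + (bif c.hasCycles 2 1 then x else 0) := by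
  have h : ∀ p q r s t u : SignType,
      (mk p q r s t u).fourCycles ≤ 1 ∧ (mk p q r s t u).triangles ≤ 2 := by
    decide +kernel
  obtain ⟨h₁, h₂⟩ := h c.e01 c.e02 c.e03 c.e12 c.e13 c.e23
  change c.fourCycles ≤ 1 at h₁
  change c.triangles ≤ 2 at h₂
  simp only [OrientedGraph.hasCycles]
  interval_cases c.fourCycles <;> interval_cases c.triangles <;> simp

theorem r42_succ (k : ℕ) :
    (r42 (k + 1) : ℤ) = cycleClassSum 0 0 k + cycleClassSum 1 0 k + cycleClassSum 0 1 k +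
      cycleClassSum 2 0 k + cycleClassSum 1 1 k + cycleClassSum 2 1 k := by
  classical
  have h : (r42 (k + 1) : ℤ) = signedSum fun c ↦ (c.totalWalks k : ℤ) := by
    simp only [r42, avoidingCount_eq_sum, Nat.cast_sum, ← OrientedGraph.sum_isChain,
      signedSum_sum, Nat.cast_ite, Nat.cast_one, Nat.cast_zero, signedSum_isChain]
  rw [h]
  simp only [cycleClassSum, ← signedSum_add]
  exact congrArg signedSum (funext fun c ↦ c.sum_hasCycles _)

theorem r42_zero : r42 0 = 1 := by
  classical
  rw [r42, avoidingCount_eq_sum]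
  simp [avoidsReversedFactors_two_iff]

/-! ### The contributions of the cycle classes -/

/-- A finite computation over all oriented graphs on four vertices. -/
theorem cycleClassSum_initial :
    (cycleClassSum 0 0 0 = -4 ∧ cycleClassSum 0 0 1 = 0 ∧ cycleClassSum 0 0 2 = 0 ∧
      cycleClassSum 0 0 3 = 0) ∧
    (cycleClassSum 1 0 0 = 32 ∧ cycleClassSum 1 0 1 = 24 ∧ cycleClassSum 1 0 2 = 24 ∧
      cycleClassSum 1 0 3 = 24) ∧
    (cycleClassSum 0 1 0 = 24 ∧ cycleClassSum 0 1 1 = 24 ∧ cycleClassSum 0 1 2 = 24 ∧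
      cycleClassSum 0 1 3 = 24) ∧
    (cycleClassSum 2 0 0 = -48 ∧ cycleClassSum 2 0 1 = -60 ∧ cycleClassSum 2 0 2 = -72 ∧
      cycleClassSum 2 0 3 = -96) ∧
    (cycleClassSum 1 1 0 = -96 ∧ cycleClassSum 1 1 1 = -120 ∧ cycleClassSum 1 1 2 = -144 ∧
      cycleClassSum 1 1 3 = -168) ∧
    (cycleClassSum 2 1 0 = 96 ∧ cycleClassSum 2 1 1 = 144 ∧ cycleClassSum 2 1 2 = 192 ∧
      cycleClassSum 2 1 3 = 264) := by
  decide +kernel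

theorem cycleClassSum_zero_zero (k : ℕ) : cycleClassSum 0 0 (k + 1) = 0 := by
  have h := cycleClassSum_initial
  match k with
  | 0 | 1 | 2 => simp [h]
  | k + 3 => simp [cycleClassSum_add_four]

theorem cycleClassSum_one_zero (k : ℕ) : cycleClassSum 1 0 (k + 1) = 24 := by
  have h := cycleClassSum_initial
  match k with
  | 0 | 1 | 2 => simp [h]
  | k + 3 => simp [cycleClassSum_add_four, cycleClassSum_one_zero k]

theorem cycleClassSum_zero_one (k : ℕ) : cycleClassSum 0 1 k = 24 := by
  have h := cycleClassSum_initial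
  match k with
  | 0 | 1 | 2 | 3 => simp [h]
  | k + 4 => simp [cycleClassSum_add_four, cycleClassSum_zero_one k]

theorem r42_add_two (k : ℕ) :
    (r42 (k + 2) : ℤ) = 48 + cycleClassSum 2 0 (k + 1) + cycleClassSum 1 1 (k + 1) +
      cycleClassSum 2 1 (k + 1) := by
  rw [r42_succ, cycleClassSum_zero_zero, cycleClassSum_one_zero, cycleClassSum_zero_one]
  ring

theorem r42_initial : (List.range 17).map r42 =
    [1, 4, 12, 24, 48, 96, 168, 264, 456, 720, 1056, 1656, 2520, 3600, 5352, 7944, 11256] := by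
  have h := cycleClassSum_initial
  have h1 : r42 1 = 4 := by
    have := r42_succ 0
    simp [h] at this
    exact_mod_cast this
  have hr : (List.range 15).map (fun k ↦ (r42 (k + 2) : ℤ)) =
      [12, 24, 48, 96, 168, 264, 456, 720, 1056, 1656, 2520, 3600, 5352, 7944, 11256] := by
    simp [List.range_succ, r42_add_two, cycleClassSum_add_four, h]
  simp [List.range_succ] at hr
  norm_cast at hr
  simp [List.range_succ, r42_zero, h1, hr]

/-- The characteristic polynomial of the recurrence is
`(X - 1) * (X ^ 3 - 2) * (X ^ 4 - X - 1) * (X ^ 4 - 2 * X - 1)`; the four factors annihilate the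
four summands in `r42_add_two`. In the proof, the coefficients of `H`, `F` and `G` are those of
the cofactors of the last three factors. -/
theorem r42_add_seventeen (m : ℕ) :
    (r42 (m + 17) : ℤ) =
      (r42 (m + 16) : ℤ) + 5 * (r42 (m + 14) : ℤ) - 3 * (r42 (m + 13) : ℤ)
        - 2 * (r42 (m + 12) : ℤ) - 8 * (r42 (m + 11) : ℤ) + (r42 (m + 10) : ℤ)
        + 6 * (r42 (m + 9) : ℤ) + 5 * (r42 (m + 8) : ℤ) + 2 * (r42 (m + 7) : ℤ)
        - 4 * (r42 (m + 6) : ℤ) - 2 * (r42 (m + 5) : ℤ) := by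
  have R (i : ℕ) := r42_add_two (m + i)
  have H (i : ℕ) := cycleClassSum_add_four 2 0 (m + i)
  have F (i : ℕ) := cycleClassSum_add_four 1 1 (m + i)
  have G (i : ℕ) := cycleClassSum_add_four 2 1 (m + i)
  simp only [Nat.cast_ofNat, Nat.cast_one, Nat.cast_zero, zero_mul, one_mul, add_zero] at H F G
  linear_combination R 15 - R 14 - 5 * R 12 + 3 * R 11 + 2 * R 10 + 8 * R 9 - R 8 - 6 * R 7
    - 5 * R 6 - 2 * R 5 + 4 * R 4 + 2 * R 3
    + H 12 - H 11 - 3 * H 9 + H 8 + 2 * H 7 + 2 * H 6 + H 5 - 2 * H 4 - H 3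
    + F 12 - F 11 - 4 * F 9 + 3 * F 8 + F 7 + 4 * F 6 - 2 * F 5 - 2 * F 4
    + G 12 - G 11 - 3 * G 9 + 2 * G 8 + G 7 + 2 * G 6 - 2 * G 4

theorem r42_recurrence {n : ℕ} (hn : 17 ≤ n) :
    (r42 n : ℤ) =
      (r42 (n - 1) : ℤ) + 5 * (r42 (n - 3) : ℤ) - 3 * (r42 (n - 4) : ℤ)
        - 2 * (r42 (n - 5) : ℤ) - 8 * (r42 (n - 6) : ℤ) + (r42 (n - 7) : ℤ)
        + 6 * (r42 (n - 8) : ℤ) + 5 * (r42 (n - 9) : ℤ) + 2 * (r42 (n - 10) : ℤ)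
        - 4 * (r42 (n - 11) : ℤ) - 2 * (r42 (n - 12) : ℤ) := by
  obtain ⟨m, rfl⟩ := Nat.exists_eq_add_of_le' hn
  exact r42_add_seventeen m

/-! ### Growth of the solutions of the recurrences -/

/-- A bound `ρ` with `t * ρ + f ≤ ρ ^ 4` dominates all roots of `X ^ 4 - t * X - f`, and the growth
bound propagates along the recurrence by induction. -/
theorem isBigO_of_add_four {u : ℕ → ℝ} {t f : ℝ} (ht : 0 ≤ t) (hf : 0 ≤ f)
    (hu : ∀ k, u (k + 4) = t * u (k + 1) + f * u k) {ρ : ℝ} (hρ : 0 < ρ)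
    (h : t * ρ + f ≤ ρ ^ 4) : u =O[atTop] fun k ↦ ρ ^ k := by
  obtain ⟨K, hK⟩ : ∃ K, ∀ i ∈ Finset.range 4, |u i| / ρ ^ i ≤ K :=
    ⟨∑ i ∈ Finset.range 4, |u i| / ρ ^ i, fun i hi ↦
      Finset.single_le_sum (f := fun i ↦ |u i| / ρ ^ i) (fun _ _ ↦ by positivity) hi⟩
  have hK0 : 0 ≤ K := (by positivity : 0 ≤ |u 0| / ρ ^ 0).trans (hK 0 (by simp))
  have hbound : ∀ k, |u k| ≤ K * ρ ^ k := by
    intro k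
    induction k using Nat.strong_induction_on with
    | _ k ih =>
      rcases lt_or_ge k 4 with hk | hk
      · exact (div_le_iff₀ (by positivity)).1 (hK k (Finset.mem_range.2 hk))
      · obtain ⟨m, rfl⟩ := Nat.exists_eq_add_of_le' hk
        calc |u (m + 4)| ≤ t * |u (m + 1)| + f * |u m| := by
              rw [hu]
              refine (abs_add_le _ _).trans_eq ?_
              rw [abs_mul, abs_mul, abs_of_nonneg ht, abs_of_nonneg hf]
          _ ≤ t * (K * ρ ^ (m + 1)) + f * (K * ρ ^ m) := by
              gcongr
              · exact ih _ (by omega)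
              · exact ih _ (by omega)
          _ = K * ρ ^ m * (t * ρ + f) := by ring
          _ ≤ K * ρ ^ m * ρ ^ 4 := by gcongr
          _ = K * ρ ^ (m + 4) := by ring
  refine IsBigO.of_bound K (Eventually.of_forall fun k ↦ ?_)
  rw [Real.norm_eq_abs, Real.norm_eq_abs, abs_of_pos (by positivity : 0 < ρ ^ k)]
  exact hbound k

/-- The quadratic form `x ^ 2 + p * x * y + q * y ^ 2` in consecutive terms is multiplied by `q` in
each step, and it is positive definite when the characteristic polynomial has no real root. -/
theorem abs_le_of_add_two {d : ℕ → ℝ} {p q : ℝ} (hpq : p ^ 2 < 4 * q)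
    (hd : ∀ k, d (k + 2) = -p * d (k + 1) - q * d k) {ρ : ℝ} (hρ : 0 ≤ ρ) (hq : q ≤ ρ ^ 2) :
    ∃ K, ∀ k, |d k| ≤ K * ρ ^ k := by
  have hq0 : 0 ≤ q := by nlinarith [sq_nonneg p]
  have hform : ∀ k, d (k + 1) ^ 2 + p * d (k + 1) * d k + q * d k ^ 2 =
      q ^ k * (d 1 ^ 2 + p * d 1 * d 0 + q * d 0 ^ 2) := by
    intro k
    induction k with
    | zero => simp
    | succ k ih => rw [hd]; linear_combination q * ih
  set Q := d 1 ^ 2 + p * d 1 * d 0 + q * d 0 ^ 2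
  have hQ : 0 ≤ Q := by
    nlinarith [sq_nonneg (d 1 + p / 2 * d 0), sq_nonneg (d 0),
      mul_nonneg (sub_nonneg.2 hpq.le) (sq_nonneg (d 0))]
  have hδ : 0 < q - p ^ 2 / 4 := by linarith
  refine ⟨√(Q / (q - p ^ 2 / 4)), fun k ↦ abs_le_of_sq_le_sq ?_ (by positivity)⟩
  rw [mul_pow, Real.sq_sqrt (by positivity), div_mul_eq_mul_div, le_div_iff₀ hδ]
  calc d k ^ 2 * (q - p ^ 2 / 4)
      ≤ d (k + 1) ^ 2 + p * d (k + 1) * d k + q * d k ^ 2 := by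
        nlinarith [sq_nonneg (d (k + 1) + p / 2 * d k)]
    _ = q ^ k * Q := hform k
    _ ≤ (ρ ^ 2) ^ k * Q := by gcongr
    _ = Q * (ρ ^ k) ^ 2 := by ring

theorem isBigO_of_sub_mul {e : ℕ → ℝ} {b ρ K : ℝ} (hb : |b| < ρ)
    (h : ∀ k, |e (k + 1) - b * e k| ≤ K * ρ ^ k) : e =O[atTop] fun k ↦ ρ ^ k := by
  have hρ : 0 < ρ := (abs_nonneg b).trans_lt hb
  have hK : 0 ≤ K := by simpa using (abs_nonneg _).trans (h 0)
  have hbound : ∀ k, |e k| ≤ (|e 0| + K / (ρ - |b|)) * ρ ^ k := by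
    intro k
    have hs : 0 < ρ - |b| := sub_pos.2 hb
    induction k with
    | zero => simpa using div_nonneg hK hs.le
    | succ k ih =>
      set M := |e 0| + K / (ρ - |b|) with hM
      have hKM : K ≤ M * (ρ - |b|) := by
        rw [← div_le_iff₀ hs, hM]
        linarith [abs_nonneg (e 0)]
      calc |e (k + 1)| = |e (k + 1) - b * e k + b * e k| := by rw [sub_add_cancel]
        _ ≤ K * ρ ^ k + |b| * |e k| := by
          rw [← abs_mul]
          exact (abs_add_le _ _).trans (by gcongr; exact h k)
        _ ≤ M * (ρ - |b|) * ρ ^ k + |b| * (M * ρ ^ k) := by gcongr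
        _ = M * ρ ^ (k + 1) := by ring
  refine IsBigO.of_bound (|e 0| + K / (ρ - |b|)) (Eventually.of_forall fun k ↦ ?_)
  rw [Real.norm_eq_abs, Real.norm_eq_abs, abs_of_pos (by positivity : 0 < ρ ^ k)]
  exact hbound k

/-! ### The dominant root -/

theorem exists_dominant_root : ∃ α : ℝ, 1.395336994467 ≤ α ∧ α ≤ 1.395336994468 ∧
    α ^ 4 - 2 * α - 1 = 0 := by
  obtain ⟨α, hα, h⟩ := intermediate_value_Icc (f := fun x : ℝ ↦ x ^ 4 - 2 * x - 1)
    (by norm_num : (1.395336994467 : ℝ) ≤ 1.395336994468) (by fun_prop)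
    (show (0 : ℝ) ∈ Set.Icc _ _ by constructor <;> norm_num)
  exact ⟨α, hα.1, hα.2, h⟩

theorem exists_negative_root : ∃ b : ℝ, -(1 / 2) ≤ b ∧ b ≤ -(2 / 5) ∧ b ^ 4 - 2 * b - 1 = 0 := by
  obtain ⟨b, hb, h⟩ := intermediate_value_Icc' (f := fun x : ℝ ↦ x ^ 4 - 2 * x - 1)
    (by norm_num : (-(1 / 2) : ℝ) ≤ -(2 / 5)) (by fun_prop)
    (show (0 : ℝ) ∈ Set.Icc _ _ by constructor <;> norm_num)
  exact ⟨b, hb.1, hb.2, h⟩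

/-- The functional `g ↦ g 3 + α g 2 + α ^ 2 g 1 + (α ^ 3 - 2) g 0` is a left eigenvector for the
shift on the solutions of the recurrence, so it gives the coefficient of `α ^ k`. What remains has
characteristic polynomial `(X ^ 4 - 2 X - 1) / (X - α) = (X - b) (X ^ 2 + p X + q)`, where `b` is
the negative root and the two complex roots have modulus `√q < 13 / 10`. -/
theorem sub_dominant_isBigO {g : ℕ → ℝ} (hg : ∀ k, g (k + 4) = 2 * g (k + 1) + g k) {α : ℝ}
    (hα₁ : 1.395336994467 ≤ α) (hα : α ^ 4 - 2 * α - 1 = 0) :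
    (fun k ↦ g k - (g 3 + α * g 2 + α ^ 2 * g 1 + (α ^ 3 - 2) * g 0) / (4 * α ^ 3 - 2) * α ^ k)
      =O[atTop] fun k ↦ (13 / 10 : ℝ) ^ k := by
  have hcoef : ∀ k, g (k + 3) + α * g (k + 2) + α ^ 2 * g (k + 1) + (α ^ 3 - 2) * g k =
      (g 3 + α * g 2 + α ^ 2 * g 1 + (α ^ 3 - 2) * g 0) * α ^ k := by
    intro k
    induction k with
    | zero => simp
    | succ k ih =>
      have h4 := hg k
      linear_combination α * ih + h4 - g k * hα
  set L := g 3 + α * g 2 + α ^ 2 * g 1 + (α ^ 3 - 2) * g 0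
  have hα3 : 4 * α ^ 3 - 2 ≠ 0 := by nlinarith
  set e : ℕ → ℝ := fun k ↦ g k - L / (4 * α ^ 3 - 2) * α ^ k with he
  have hcubic : ∀ k, e (k + 3) + α * e (k + 2) + α ^ 2 * e (k + 1) + (α ^ 3 - 2) * e k = 0 := by
    intro k
    have h1 : L / (4 * α ^ 3 - 2) * (4 * α ^ 3 - 2) = L := div_mul_cancel₀ _ hα3
    simp only [he]
    linear_combination hcoef k - α ^ k * h1
  obtain ⟨b, hb₁, hb₂, hb⟩ := exists_negative_root
  have hαb : α ^ 3 + α ^ 2 * b + α * b ^ 2 + b ^ 3 = 2 := by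
    have : (α - b) * (α ^ 3 + α ^ 2 * b + α * b ^ 2 + b ^ 3 - 2) = 0 := by
      linear_combination hα - hb
    rcases mul_eq_zero.1 this with h | h <;> linarith
  obtain ⟨K, hK⟩ := abs_le_of_add_two (d := fun k ↦ e (k + 1) - b * e k) (p := α + b)
    (q := α ^ 2 + α * b + b ^ 2) (ρ := 13 / 10) (by nlinarith)
    (fun k ↦ by linear_combination hcubic k - e k * hαb) (by norm_num) (by nlinarith)
  exact isBigO_of_sub_mul (abs_lt.2 ⟨by linarith, by linarith⟩) hK

theorem isGreatest_dominant_root {α : ℝ} (hα₁ : 1.395336994467 ≤ α)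
    (hα : α ^ 4 - 2 * α - 1 = 0) : IsGreatest {x : ℝ | x ^ 4 - 2 * x - 1 = 0} α := by
  refine ⟨hα, fun x (hx : x ^ 4 - 2 * x - 1 = 0) ↦ ?_⟩
  by_contra! h
  nlinarith [pow_lt_pow_left₀ h (by linarith) (n := 3) (by norm_num),
    pow_le_pow_left₀ (by norm_num) hα₁ 3]

/-- Together with the class of two triangles and one four-cycle, `t = 2` and `f = 1`, which violates
the hypothesis, the classes that satisfy it exhaust the oriented graphs. -/
theorem cycleClassSum_isBigO (t f : ℕ) (h : (t : ℝ) * (13 / 10) + f ≤ (13 / 10) ^ 4) :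
    (fun k ↦ (cycleClassSum t f k : ℝ)) =O[atTop] fun k ↦ (13 / 10 : ℝ) ^ k :=
  isBigO_of_add_four t.cast_nonneg f.cast_nonneg
    (fun k ↦ by exact_mod_cast cycleClassSum_add_four t f k) (by norm_num) h

theorem r42_succ_sub_dominant_isBigO {α : ℝ} (hα₁ : 1.395336994467 ≤ α)
    (hα : α ^ 4 - 2 * α - 1 = 0) :
    (fun k ↦ (r42 (k + 1) : ℝ) -
      (264 + α * 192 + α ^ 2 * 144 + (α ^ 3 - 2) * 96) / (4 * α ^ 3 - 2) * α ^ k)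
      =O[atTop] fun k ↦ (13 / 10 : ℝ) ^ k := by
  have h := cycleClassSum_initial
  have hG := sub_dominant_isBigO (g := fun k ↦ (cycleClassSum 2 1 k : ℝ))
    (fun k ↦ by have := cycleClassSum_add_four 2 1 k; simp at this; exact_mod_cast this) hα₁ hα
  simp only [h, Int.cast_ofNat] at hG
  refine (((((cycleClassSum_isBigO 0 0 (by norm_num)).add
    (cycleClassSum_isBigO 1 0 (by norm_num))).add
    (cycleClassSum_isBigO 0 1 (by norm_num))).add
    (cycleClassSum_isBigO 2 0 (by norm_num))).add
    (cycleClassSum_isBigO 1 1 (by norm_num))).add hG |>.congr_left fun k ↦ ?_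
  have hk : (r42 (k + 1) : ℝ) = ((r42 (k + 1) : ℤ) : ℝ) := by norm_cast
  rw [hk, r42_succ]
  push_cast
  ring

/-- The value of the constant, with the denominator `α * (4 * α ^ 3 - 2)` simplified by means of the
equation for `α`. -/
theorem leading_coefficient_eq {α : ℝ} (hα₁ : 1.395336994467 ≤ α)
    (hα : α ^ 4 - 2 * α - 1 = 0) :
    (264 + α * 192 + α ^ 2 * 144 + (α ^ 3 - 2) * 96) / (4 * α ^ 3 - 2) =
      (36 + 96 * α + 72 * α ^ 2 + 48 * α ^ 3) / (3 * α + 2) * α := by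
  have h3 : 4 * α ^ 3 - 2 ≠ 0 := by nlinarith
  have h1 : 3 * α + 2 ≠ 0 := by linarith
  rw [div_mul_eq_mul_div, div_eq_div_iff h3 h1]
  linear_combination (-144 - 384 * α - 288 * α ^ 2 - 192 * α ^ 3) * hα

theorem corollary15 :
    (List.range 17).map r42 =
      [1, 4, 12, 24, 48, 96, 168, 264, 456, 720, 1056, 1656, 2520, 3600, 5352, 7944, 11256] ∧
    (∀ n : ℕ, 17 ≤ n →
      (r42 n : ℤ) =
        (r42 (n - 1) : ℤ) + 5 * (r42 (n - 3) : ℤ) - 3 * (r42 (n - 4) : ℤ)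
          - 2 * (r42 (n - 5) : ℤ) - 8 * (r42 (n - 6) : ℤ) + (r42 (n - 7) : ℤ)
          + 6 * (r42 (n - 8) : ℤ) + 5 * (r42 (n - 9) : ℤ) + 2 * (r42 (n - 10) : ℤ)
          - 4 * (r42 (n - 11) : ℤ) - 2 * (r42 (n - 12) : ℤ)) ∧
    (∃ α C : ℝ,
      IsGreatest {x : ℝ | x ^ 4 - 2 * x - 1 = 0} α ∧
      |α - 1.395336994| ≤ 5e-10 ∧
      |C - 71.2145756| ≤ 5e-8 ∧
      (fun n : ℕ => (r42 n : ℝ)) ~[atTop] (fun n : ℕ => C * α ^ n)) := by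
  refine ⟨r42_initial, fun n hn ↦ r42_recurrence hn, ?_⟩
  obtain ⟨α, hα₁, hα₂, hα⟩ := exists_dominant_root
  have hα0 : 0 < α := by linarith
  have hC : |(36 + 96 * α + 72 * α ^ 2 + 48 * α ^ 3) / (3 * α + 2) - 71.2145756| ≤ 5e-8 := by
    have hsq₁ : (1.395336994467 : ℝ) ^ 2 ≤ α ^ 2 := by gcongr
    have hsq₂ : α ^ 2 ≤ (1.395336994468 : ℝ) ^ 2 := by gcongr
    have hcu₁ : (1.395336994467 : ℝ) ^ 3 ≤ α ^ 3 := by gcongr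
    have hcu₂ : α ^ 3 ≤ (1.395336994468 : ℝ) ^ 3 := by gcongr
    have h1 : 0 < 3 * α + 2 := by linarith
    rw [abs_sub_le_iff, sub_le_iff_le_add, sub_le_comm, div_le_iff₀ h1, le_div_iff₀ h1]
    constructor <;> norm_num at * <;> linarith
  refine ⟨α, _, isGreatest_dominant_root hα₁ hα, ?_, hC, ?_⟩
  · rw [abs_le]
    constructor <;> linarith
  set C := (36 + 96 * α + 72 * α ^ 2 + 48 * α ^ 3) / (3 * α + 2)
  have hC0 : C ≠ 0 := by
    intro h
    rw [h] at hC
    norm_num [abs_le] at hC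
  have hO := r42_succ_sub_dominant_isBigO hα₁ hα
  rw [leading_coefficient_eq hα₁ hα] at hO
  have ho : (fun k ↦ (r42 (k + 1) : ℝ) - C * α * α ^ k) =o[atTop] fun k ↦ C * α * α ^ k := by
    refine hO.trans_isLittleO ?_
    exact (isLittleO_pow_pow_of_lt_left (by norm_num) (by linarith)).const_mul_right
      (mul_ne_zero hC0 hα0.ne')
  -- Pass from `r42 (k + 1)` to `r42 n` with `n = k + 1`.
  have ht := ho.comp_tendsto (tendsto_sub_atTop_nat 1)
  refine ht.congr' ?_ ?_ <;>
  · filter_upwards [eventually_ge_atTop 1] with n hn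
    obtain ⟨k, rfl⟩ := Nat.exists_eq_add_of_le' hn
    simp [pow_succ']
    try ring
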